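/- Let $X_1, X_2, \dots$ be independent, identically distributed random variables with values in $[0,1]$, let $c \ge 0$ be a cost per observation, and let $Y_i = X_i - ic$ for $i = 1, 2, \dots$. For $n \ge 1$ put $$M(Y_1,\dots,Y_n) = E\Bigl(\max_{1\le i\le n} Y_i\Bigr), \qquad V(Y_1,\dots,Y_n) = \sup_{\tau} E(Y_\tau),$$ where $\tau$ ranges over all stopping rules for $Y_1,\dots,Y_n$, that is, over all $\{1,\dots,n\}$-valued stopping times with respect to the filtration generated by $Y_1, Y_2, \dots$. For a real number $x$ let $[x]$ denote the largest integer strictly smaller than $x$. Then: (a) For every $0 < c \le 1$ and all $n \ge 1$, $$M(Y_1,\dots,Y_n) - V(Y_1,\dots,Y_n) \le \begin{cases} [1/c]\,c\,(1-c)^{[1/c]+1}, & c \le 1/2,\\ (1-c)/4, & c \ge 1/2.\end{cases}$$ (b) For every $n \ge 1$ and all $c \ge 0$, $$M(Y_1,\dots,Y_n) - V(Y_1,\dots,Y_n) \le \frac{(n-1)\,\bigl(1-\frac{1}{n+1}\bigr)^n}{n+1}.$$ (c) For all $c \ge 0$ and all $n \ge 1$, $$M(Y_1,\dots,Y_n)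 - V(Y_1,\dots,Y_n) < e^{-1}.$$ All bounds are the best possible: for every $0 < c \le 1$ there are an $n \ge 1$ and a sequence of i.i.d. $[0,1]$-valued random variables for which equality holds in (a); for every $n \ge 1$ there are a $c \ge 0$ and such a sequence for which equality holds in (b); and in (c) no constant smaller than $e^{-1}$ is an upper bound for all $c \ge 0$, all $n \ge 1$ and all such sequences. -/

import Mathlib

open MeasureTheory ProbabilityTheory

/-- `[x]`: the largest integer strictly smaller than the real number `x`. -/
noncomputable def strictFloor (x : ℝ) : ℤ := ⌈x⌉ - 1

theorem strictFloor_isGreatest (x : ℝ) : IsGreatest {m : ℤ | (m : ℝ) < x} (strictFloor x) := by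
  constructor
  · have := Int.ceil_lt_add_one x
    simp only [Set.mem_ofPred_eq, strictFloor, Int.cast_sub, Int.cast_one]
    linarith
  · intro m hm
    have : m < ⌈x⌉ := Int.lt_ceil.mpr hm
    unfold strictFloor
    omega

/-- `X 0, X 1, X 2, …` (standing for `X₁, X₂, X₃, …`) are independent, identically distributed
real random variables with values in `[0, 1]` (almost surely). -/
structure IsUnitIID {Ω : Type*} [MeasurableSpace Ω] (P : Measure Ω) (X : ℕ → Ω → ℝ) : Prop where
  measurable : ∀ i, Measurable (X i)
  indep : iIndepFun X P
  identDistrib : ∀ i, IdentDistrib (X i) (X 0) P P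
  mem_unit : ∀ᵐ ω ∂P, X 0 ω ∈ Set.Icc (0 : ℝ) 1

/-- The sequence `Yᵢ = Xᵢ - i c`. Indices start at `0` here, so that `netReturn X c i` is the
`(i + 1)`-st member of the sequence and carries the cost of `i + 1` observations. -/
def netReturn {Ω : Type*} (X : ℕ → Ω → ℝ) (c : ℝ) (i : ℕ) (ω : Ω) : ℝ :=
  X i ω - ((i : ℝ) + 1) * c

theorem stronglyMeasurable_netReturn {Ω : Type*} [MeasurableSpace Ω] {X : ℕ → Ω → ℝ}
    (hX : ∀ i, Measurable (X i)) (c : ℝ) (i : ℕ) : StronglyMeasurable (netReturn X c i) :=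
  ((hX i).sub_const _).stronglyMeasurable

/-- The prophet's value `M = E (max of the first n members of Y)`, for `n ≥ 1`. -/
noncomputable def prophetValue {Ω : Type*} [MeasurableSpace Ω] (P : Measure Ω)
    (Y : ℕ → Ω → ℝ) (n : ℕ) : ℝ :=
  ∫ ω, (⨆ i : Fin n, Y i ω) ∂P

/-- The stopping rules for the first `n` members of `Y`: stopping times with respect to the
filtration generated by `Y` that take one of the `n` (zero-based) values `0, …, n - 1`. -/
def stoppingRules {Ω : Type*} [MeasurableSpace Ω] (Y : ℕ → Ω → ℝ)
    (hY : ∀ i, StronglyMeasurable (Y i)) (n : ℕ) : Set (Ω → WithTop ℕ) :=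
  {τ | IsStoppingTime (Filtration.natural Y hY) τ ∧ ∀ ω, τ ω < (n : WithTop ℕ)}

/-- The statistician's value `V`: the supremum of `E Y_τ` over the stopping rules `τ` for the
first `n` members of `Y`. -/
noncomputable def optimalValue {Ω : Type*} [MeasurableSpace Ω] (P : Measure Ω) (Y : ℕ → Ω → ℝ)
    (hY : ∀ i, StronglyMeasurable (Y i)) (n : ℕ) : ℝ :=
  sSup ((fun τ => ∫ ω, stoppedValue Y τ ω ∂P) '' stoppingRules Y hY n)

/-- The difference `M - V` for the first `n` members of the sequence `Yᵢ = Xᵢ - i c`. -/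
noncomputable def prophetGap {Ω : Type*} [MeasurableSpace Ω] (P : Measure Ω) (X : ℕ → Ω → ℝ)
    (hX : ∀ i, Measurable (X i)) (c : ℝ) (n : ℕ) : ℝ :=
  prophetValue P (netReturn X c) n -
    optimalValue P (netReturn X c) (stronglyMeasurable_netReturn hX c) n

/-- `d` is a value of `M - V` that occurs for horizon `n` and cost `c`, for some independent and
identically distributed sequence of `[0, 1]`-valued random variables on some probability space. -/
def IsAttainedGap (c : ℝ) (n : ℕ) (d : ℝ) : Prop :=
  ∃ (Ω : Type) (_ : MeasurableSpace Ω) (P : Measure Ω) (_ : IsProbabilityMeasure P)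
    (X : ℕ → Ω → ℝ) (hX : IsUnitIID P X), prophetGap P X hX.measurable c n = d

theorem tangent_le_pow_sub_pow {a b : ℝ} (ha : 0 ≤ a) (hb : 0 ≤ b) (k : ℕ) :
    ((k : ℝ) + 1) * b ^ k * (a - b) ≤ a ^ (k + 1) - b ^ (k + 1) := by
  induction k with
  | zero => simp
  | succ k ih =>
    have h1 : 0 ≤ ((k : ℝ) + 1) * b ^ k * (a - b) ^ 2 := by positivity
    have h2 := mul_le_mul_of_nonneg_left ih ha
    push_cast
    calc _ = a * (((k : ℝ) + 1) * b ^ k * (a - b)) + b ^ (k + 1) * (a - b)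
          - ((k : ℝ) + 1) * b ^ k * (a - b) ^ 2 := by ring
      _ ≤ a * (a ^ (k + 1) - b ^ (k + 1)) + b ^ (k + 1) * (a - b) := by linarith
      _ = _ := by ring

theorem mul_one_sub_pow_sub_ge {x y : ℝ} (hx1 : x ≤ 1) (hy0 : 0 ≤ y) (hy1 : y ≤ 1) (k : ℕ) :
    (1 - x) ^ k * ((y - x) * (1 - x - (k + 1) * y)) ≤
      y * (1 - y) ^ (k + 1) - x * (1 - x) ^ (k + 1) := by
  have h := mul_le_mul_of_nonneg_left
    (tangent_le_pow_sub_pow (sub_nonneg.2 hy1) (sub_nonneg.2 hx1) k) hy0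
  calc _ = y * (((k : ℝ) + 1) * (1 - x) ^ k * ((1 - y) - (1 - x))) +
        (y - x) * (1 - x) ^ (k + 1) := by ring
    _ ≤ y * ((1 - y) ^ (k + 1) - (1 - x) ^ (k + 1)) + (y - x) * (1 - x) ^ (k + 1) := by linarith
    _ = _ := by ring

theorem mul_one_sub_pow_le {x y : ℝ} (hx1 : x ≤ 1) (hy0 : 0 ≤ y) (hy1 : y ≤ 1) (k : ℕ)
    (h : 0 ≤ (y - x) * (1 - x - (k + 1) * y)) :
    x * (1 - x) ^ (k + 1) ≤ y * (1 - y) ^ (k + 1) := by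
  have := mul_one_sub_pow_sub_ge hx1 hy0 hy1 k
  have h2 := mul_nonneg (pow_nonneg (sub_nonneg.2 hx1) k) h
  linarith

/-- The maximum over `x` of `n x (1 - x) ^ (n + 1)`. -/
noncomputable def horizonBound (n : ℕ) : ℝ :=
  n * (1 / ((n : ℝ) + 2) * (1 - 1 / ((n : ℝ) + 2)) ^ (n + 1))

theorem mul_pow_le_horizonBound {x : ℝ} (hx : x ≤ 1) (n : ℕ) :
    n * (x * (1 - x) ^ (n + 1)) ≤ horizonBound n := by
  have h1 : (0 : ℝ) ≤ 1 / ((n : ℝ) + 2) := by positivity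
  have h2 : 1 / ((n : ℝ) + 2) ≤ 1 := by
    rw [div_le_one (by positivity)]
    have : (0 : ℝ) ≤ n := n.cast_nonneg
    linarith
  refine mul_le_mul_of_nonneg_left (mul_one_sub_pow_le hx h1 h2 n ?_) n.cast_nonneg
  have : 1 - x - ((n : ℝ) + 1) * (1 / ((n : ℝ) + 2)) = 1 / ((n : ℝ) + 2) - x := by
    field_simp
    ring
  rw [this]
  exact mul_self_nonneg _

theorem horizonBound_mono : Monotone horizonBound := by
  refine monotone_nat_of_le_succ fun n => ?_
  refine le_trans ?_ (mul_pow_le_horizonBound (x := 1 / ((n : ℝ) + 2)) ?_ (n + 1))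
  · have hn : (0 : ℝ) ≤ n := n.cast_nonneg
    have h0 : 1 - 1 / ((n : ℝ) + 2) = ((n : ℝ) + 1) / (n + 2) := by field_simp; ring
    unfold horizonBound
    rw [pow_succ _ (n + 1), h0]
    have h1 : (n : ℝ) ≤ ((n + 1 : ℕ) : ℝ) * (((n : ℝ) + 1) / (n + 2)) := by
      push_cast
      rw [mul_div_assoc', le_div_iff₀ (by positivity)]
      nlinarith
    have h2 : 0 ≤ 1 / ((n : ℝ) + 2) * (((n : ℝ) + 1) / (n + 2)) ^ (n + 1) := by positivity
    calc _ ≤ _ := mul_le_mul_of_nonneg_right h1 h2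
      _ = _ := by ring
  · rw [div_le_one (by positivity)]
    have : (0 : ℝ) ≤ n := n.cast_nonneg
    linarith

theorem horizonBound_eq (n : ℕ) : horizonBound n =
    (((n + 1 : ℕ) : ℝ) - 1) * (1 - 1 / (((n + 1 : ℕ) : ℝ) + 1)) ^ (n + 1) /
      (((n + 1 : ℕ) : ℝ) + 1) := by
  unfold horizonBound
  push_cast
  have h : (n : ℝ) + 1 + 1 = n + 2 := by ring
  rw [h]
  ring

theorem horizonBound_lt_exp (n : ℕ) : horizonBound n < Real.exp (-1) := by
  have hn : (0 : ℝ) ≤ n := n.cast_nonneg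
  have h0 : 1 - 1 / ((n : ℝ) + 2) = ((n : ℝ) + 1) / (n + 2) := by field_simp; ring
  have hexp : (1 - 1 / ((n : ℝ) + 2)) ≤ Real.exp (-(1 / ((n : ℝ) + 2))) := by
    have := Real.add_one_le_exp (-(1 / ((n : ℝ) + 2)))
    linarith
  have hpow : (1 - 1 / ((n : ℝ) + 2)) ^ (n + 2) ≤ Real.exp (-1) := by
    calc _ ≤ Real.exp (-(1 / ((n : ℝ) + 2))) ^ (n + 2) := by
          refine pow_le_pow_left₀ ?_ hexp _
          rw [h0]; positivity
      _ = Real.exp (-1) := by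
          rw [← Real.exp_nat_mul]
          congr 1
          push_cast
          field_simp
  refine lt_of_lt_of_le ?_ hpow
  unfold horizonBound
  rw [pow_succ _ (n + 1), h0, ← mul_assoc, mul_comm ((((n : ℝ) + 1) / (n + 2)) ^ (n + 1))]
  refine mul_lt_mul_of_pos_right ?_ (by positivity)
  rw [mul_one_div]
  exact div_lt_div_of_pos_right (by linarith) (by positivity)

theorem geom_weighted_sum {s : ℝ} (hs : s ≠ 0) (b c : ℝ) (m : ℕ) :
    s * ∑ k ∈ Finset.range m, (1 - s) ^ (k + 1) * (b - (k + 1) * c) =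
      (1 - s) * (1 - (1 - s) ^ m) * (b - c / s) + c * m * (1 - s) ^ (m + 1) := by
  induction m with
  | zero => simp
  | succ m ih =>
    rw [Finset.sum_range_succ, mul_add, ih]
    push_cast
    field_simp
    ring

theorem sum_pos_part_eq {c : ℝ} (hc : 0 ≤ c) (q b : ℝ) (n : ℕ) :
    ∃ m ≤ n, (m = 0 ∨ m * c < b) ∧
      ∑ k ∈ Finset.range n, q ^ (k + 1) * max (b - (k + 1) * c) 0 =
        ∑ k ∈ Finset.range m, q ^ (k + 1) * (b - (k + 1) * c) := by
  induction n with
  | zero => exact ⟨0, le_rfl, Or.inl rfl, by simp⟩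
  | succ n ih =>
    by_cases h : ((n : ℝ) + 1) * c < b
    · refine ⟨n + 1, le_rfl, Or.inr (by push_cast; exact h), Finset.sum_congr rfl fun k hk => ?_⟩
      rw [max_eq_left]
      have : (k : ℝ) ≤ n := by exact_mod_cast Nat.lt_succ_iff.1 (Finset.mem_range.1 hk)
      nlinarith
    · obtain ⟨m, hm, h1, h2⟩ := ih
      refine ⟨m, by omega, h1, ?_⟩
      rw [Finset.sum_range_succ, h2, max_eq_right (by linarith)]
      simp

theorem weighted_sum_le {s b c : ℝ} (hs : 0 < s) (hs1 : s ≤ 1) (hcs : c ≤ s) {n m : ℕ}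
    (hmn : m ≤ n) (hb : b - c / s ≤ (1 - c / s) * (1 - s) ^ n) :
    s * ∑ k ∈ Finset.range m, (1 - s) ^ (k + 1) * (b - (k + 1) * c) ≤
      m * (s * (1 - s) ^ (m + 1)) := by
  have hr : 0 ≤ 1 - c / s := sub_nonneg.2 ((div_le_one hs).2 hcs)
  have hq0 : 0 ≤ 1 - s := sub_nonneg.2 hs1
  have hq1 : 1 - s ≤ 1 := by linarith
  have hqm : (1 - s) ^ m ≤ 1 := pow_le_one₀ hq0 hq1
  have hb' : b - c / s ≤ (1 - c / s) * (1 - s) ^ m :=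
    hb.trans (mul_le_mul_of_nonneg_left (pow_le_pow_of_le_one hq0 hq1 hmn) hr)
  have hbern : 1 - (1 - s) ^ m ≤ m * s := by
    have := one_add_mul_le_pow (a := -s) (by linarith) m
    rw [← sub_eq_add_neg] at this
    linarith
  rw [geom_weighted_sum hs.ne']
  calc _ ≤ (1 - s) * (1 - (1 - s) ^ m) * ((1 - c / s) * (1 - s) ^ m) +
        c * m * (1 - s) ^ (m + 1) := by
        gcongr
    _ = (1 - s) ^ (m + 1) * ((1 - c / s) * (1 - (1 - s) ^ m) + c * m) := by ring
    _ ≤ (1 - s) ^ (m + 1) * ((1 - c / s) * (m * s) + c * m) := by gcongr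
    _ = _ := by field_simp; ring

/-- The upper bound for the gap in terms of the mean excess `s` and the range `b`. -/
noncomputable def excessBound (s b c : ℝ) (n : ℕ) : ℝ :=
  s * ∑ k ∈ Finset.range n, (1 - s) ^ (k + 1) * max (b - (k + 1) * c) 0

/-- The constraint that links mean excess, range, cost and horizon. -/
def ExcessAdmissible (s b c : ℝ) (n : ℕ) : Prop :=
  0 ≤ s ∧ s ≤ 1 ∧ b ≤ 1 ∧
    ((s ≤ c ∧ b = 1) ∨ (0 < s ∧ c ≤ s ∧ b - c / s ≤ (1 - c / s) * (1 - s) ^ n))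

theorem excessBound_le_horizonBound {s b c : ℝ} (hc : 0 ≤ c) {n : ℕ}
    (h : ExcessAdmissible s b c n) : excessBound s b c n ≤ horizonBound n := by
  obtain ⟨hs0, hs1, -, h⟩ := h
  have key : ∀ c' : ℝ, 0 ≤ c' → 0 < s → c' ≤ s → b - c' / s ≤ (1 - c' / s) * (1 - s) ^ n →
      excessBound s b c' n ≤ horizonBound n := by
    intro c' hc' hs hcs hb
    obtain ⟨m, hmn, -, hm⟩ := sum_pos_part_eq hc' (1 - s) b n
    rw [excessBound, hm]
    exact (weighted_sum_le hs hs1 hcs hmn hb).trans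
      ((mul_pow_le_horizonBound hs1 m).trans (horizonBound_mono hmn))
  rcases h with ⟨hsc, rfl⟩ | ⟨hs, hcs, hb⟩
  · rcases hs0.eq_or_lt with rfl | hs
    · simp only [excessBound, zero_mul]
      exact (by simp [horizonBound] : (0 : ℝ) = horizonBound 0).le.trans (horizonBound_mono n.zero_le)
    · refine le_trans ?_ (key s hs0 hs le_rfl (by simp [hs.ne']))
      unfold excessBound
      have : (0 : ℝ) ≤ 1 - s := by linarith
      gcongr
  · exact key c hc hs hcs hb

theorem excessBound_le_of_half_le {s b c : ℝ} (hc : 1 / 2 ≤ c) (hc1 : c ≤ 1) {n : ℕ}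
    (h : ExcessAdmissible s b c n) : excessBound s b c n ≤ (1 - c) / 4 := by
  obtain ⟨hs0, hs1, hb1, h⟩ := h
  obtain ⟨m, hmn, hmb, hm⟩ := sum_pos_part_eq (by linarith : 0 ≤ c) (1 - s) b n
  have hq : s * (1 - s) ≤ 1 / 4 := by nlinarith [sq_nonneg (s - 1 / 2)]
  have hm1 : m ≤ 1 := by
    by_contra hcon
    have : (2 : ℝ) ≤ m := by exact_mod_cast (by omega : 2 ≤ m)
    rcases hmb with rfl | hmb
    · omega
    · nlinarith
  rw [excessBound, hm]
  interval_cases m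
  · simp; linarith
  · rcases h with ⟨hsc, rfl⟩ | ⟨hs, hcs, hb⟩
    · simp
      nlinarith
    · have := weighted_sum_le hs hs1 hcs hmn hb
      refine this.trans ?_
      have : 0 ≤ s * (1 - s) := mul_nonneg hs0 (by linarith)
      norm_num
      nlinarith

theorem sum_mul_pow_at_cost {c : ℝ} (hc : 0 < c) (m : ℕ) :
    c * ∑ k ∈ Finset.range m, (1 - c) ^ (k + 1) * (1 - (k + 1) * c) =
      m * (c * (1 - c) ^ (m + 1)) := by
  rw [geom_weighted_sum hc.ne', div_self hc.ne']
  ring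

theorem sum_mul_pow_le_of_le_cost {s c : ℝ} (hs0 : 0 ≤ s) (hsc : s ≤ c) (hc : 0 < c)
    (hc2 : c ≤ 1 / 2) {M : ℕ} (hM1 : M * c < 1) (hM2 : 1 ≤ (M + 1) * c) :
    s * ∑ k ∈ Finset.range M, (1 - s) ^ (k + 1) * (1 - (k + 1) * c) ≤
      c * ∑ k ∈ Finset.range M, (1 - c) ^ (k + 1) * (1 - (k + 1) * c) := by
  have hs1 : s ≤ 1 := by linarith
  match M, hM1, hM2 with
  | 0, _, h => norm_num at h; linarith
  | 1, _, h =>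
    norm_num at h
    have : c = 1 / 2 := by linarith
    subst this
    norm_num
    nlinarith [sq_nonneg (s - 1 / 2)]
  | M + 2, h1, h2 =>
    push_cast at h1 h2
    have hM0 : (0 : ℝ) ≤ M := M.cast_nonneg
    rw [Finset.sum_range_succ, Finset.sum_range_succ', Finset.sum_range_succ _ (M + 1),
      Finset.sum_range_succ' _ M, mul_add, mul_add, mul_add, mul_add]
    have hmid : s * ∑ k ∈ Finset.range M, (1 - s) ^ (k + 1 + 1) * (1 - (((k + 1 : ℕ) : ℝ) + 1) * c)
        ≤ c * ∑ k ∈ Finset.range M, (1 - c) ^ (k + 1 + 1) * (1 - (((k + 1 : ℕ) : ℝ) + 1) * c) := by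
      rw [Finset.mul_sum, Finset.mul_sum]
      refine Finset.sum_le_sum fun k hk => ?_
      have hkM : (k : ℝ) + 1 ≤ M := by exact_mod_cast Finset.mem_range.1 hk
      have hkc : ((k : ℝ) + 2 + 1) * c ≤ 1 := by nlinarith
      rw [← mul_assoc, ← mul_assoc]
      refine mul_le_mul_of_nonneg_right (mul_one_sub_pow_le hs1 hc.le (by linarith) _ ?_) ?_
      · push_cast
        exact mul_nonneg (by linarith) (by linarith)
      · push_cast; linarith
    have hlast := mul_one_sub_pow_sub_ge hs1 hc.le (by linarith : c ≤ 1) (M + 1)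
    push_cast at hlast hmid ⊢
    have hA : 0 ≤ 1 - ((M : ℝ) + 1 + 1) * c := by linarith
    have hlast' := mul_le_mul_of_nonneg_right hlast hA
    have hpow : (1 - s) ^ (M + 1) ≤ 1 := pow_le_one₀ (by linarith) (by linarith)
    have hpow0 : 0 ≤ (1 - s) ^ (M + 1) := pow_nonneg (by linarith) _
    have hcomb : 0 ≤ (c - s) * ((1 - c) * (1 - s - c)) +
        (1 - s) ^ (M + 1) * ((c - s) * (1 - s - ((M : ℝ) + 1 + 1) * c)) *
          (1 - ((M : ℝ) + 1 + 1) * c) := by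
      have e1 : 1 - ((M : ℝ) + 1 + 1) * c ≤ 1 - s - c := by nlinarith
      have e2 : s + ((M : ℝ) + 1 + 1) * c - 1 ≤ 1 - c := by linarith
      have e3 : (1 - s) ^ (M + 1) * (1 - ((M : ℝ) + 1 + 1) * c) ≤ 1 - s - c :=
        (mul_le_of_le_one_left hA hpow).trans e1
      have e4 : (1 - s) ^ (M + 1) * (1 - ((M : ℝ) + 1 + 1) * c) *
          (s + ((M : ℝ) + 1 + 1) * c - 1) ≤ (1 - s - c) * (1 - c) := by
        refine (mul_le_mul_of_nonneg_left e2 (mul_nonneg hpow0 hA)).trans ?_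
        exact mul_le_mul_of_nonneg_right e3 (by linarith)
      have e5 := mul_nonneg (sub_nonneg.2 hsc) (sub_nonneg.2 e4)
      nlinarith
    simp only [zero_add, pow_one, one_mul]
    linarith

theorem mul_pow_le_of_cost_le {s c : ℝ} (hcs : c ≤ s) (hs1 : s ≤ 1) (hc : 0 < c)
    {M m : ℕ} (hmM : m ≤ M) (hM1 : M * c < 1) (hM2 : 1 ≤ (M + 1) * c) :
    m * (s * (1 - s) ^ (m + 1)) ≤ M * (c * (1 - c) ^ (M + 1)) := by
  have hc1 : c ≤ 1 := hcs.trans hs1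
  have hq0 : 0 ≤ 1 - c := by linarith
  by_cases hm : M ≤ m + 1
  · have hMm : (M : ℝ) ≤ m + 1 := by exact_mod_cast hm
    have h1 : m * (s * (1 - s) ^ (m + 1)) ≤ m * (c * (1 - c) ^ (m + 1)) := by
      refine mul_le_mul_of_nonneg_left (mul_one_sub_pow_le hs1 hc.le hc1 m ?_) m.cast_nonneg
      exact mul_nonneg_of_nonpos_of_nonpos (by linarith) (by nlinarith)
    refine h1.trans ?_
    rcases hmM.eq_or_lt with rfl | hlt
    · exact le_rfl
    · obtain rfl : M = m + 1 := by omega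
      push_cast at hM1 ⊢
      have h2 : (m : ℝ) ≤ (m + 1) * (1 - c) := by nlinarith
      have h3 : 0 ≤ c * (1 - c) ^ (m + 1) := by positivity
      calc _ ≤ ((m : ℝ) + 1) * (1 - c) * (c * (1 - c) ^ (m + 1)) :=
            mul_le_mul_of_nonneg_right h2 h3
        _ = _ := by ring
  · obtain ⟨K, rfl⟩ : ∃ K, M = K + 2 := ⟨M - 2, by omega⟩
    have hK : (0 : ℝ) ≤ K := K.cast_nonneg
    have h1 : m * (s * (1 - s) ^ (m + 1)) ≤ horizonBound K :=
      (mul_pow_le_horizonBound hs1 m).trans (horizonBound_mono (by omega))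
    refine h1.trans ?_
    push_cast at hM1 hM2 ⊢
    have hy1 : 1 / ((K : ℝ) + 2) ≤ 1 := by
      rw [div_le_one (by positivity)]; linarith
    have hcy : c ≤ 1 / ((K : ℝ) + 2) := by
      rw [le_div_iff₀ (by positivity)]; linarith
    have h2 := mul_one_sub_pow_le hy1 hc.le hc1 (K + 2) (by
      push_cast
      refine mul_nonneg_of_nonpos_of_nonpos (by linarith) ?_
      have : (0 : ℝ) ≤ 1 / ((K : ℝ) + 2) := by positivity
      linarith)
    refine le_trans ?_ (mul_le_mul_of_nonneg_left h2 (by positivity : (0 : ℝ) ≤ (K : ℝ) + 2))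
    have h0 : 1 - 1 / ((K : ℝ) + 2) = ((K : ℝ) + 1) / (K + 2) := by field_simp; ring
    unfold horizonBound
    rw [h0]
    have h3 : (K : ℝ) ≤ (K + 2) * (((K : ℝ) + 1) / (K + 2)) ^ 2 := by
      rw [div_pow, mul_div_assoc', le_div_iff₀ (by positivity)]
      nlinarith
    have h4 : 0 ≤ 1 / ((K : ℝ) + 2) * (((K : ℝ) + 1) / (K + 2)) ^ (K + 1) := by positivity
    calc _ ≤ _ := mul_le_mul_of_nonneg_right h3 h4
      _ = _ := by ring

theorem excessBound_le_of_le_half {s b c : ℝ} (hc : 0 < c) (hc2 : c ≤ 1 / 2) {n M : ℕ}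
    (hM1 : M * c < 1) (hM2 : 1 ≤ (M + 1) * c) (h : ExcessAdmissible s b c n) :
    excessBound s b c n ≤ M * (c * (1 - c) ^ (M + 1)) := by
  obtain ⟨hs0, hs1, hb1, h⟩ := h
  obtain ⟨m, hmn, hmb, hm⟩ := sum_pos_part_eq hc.le (1 - s) b n
  have hmM : m ≤ M := by
    rcases hmb with rfl | hmb
    · exact M.zero_le
    · have : (m : ℝ) * c < (M + 1) * c := by linarith
      have := lt_of_mul_lt_mul_right this hc.le
      exact Nat.lt_succ_iff.1 (by exact_mod_cast this)
  rw [excessBound, hm]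
  rcases h with ⟨hsc, rfl⟩ | ⟨hs, hcs, hb⟩
  · rw [← sum_mul_pow_at_cost hc]
    refine le_trans (mul_le_mul_of_nonneg_left ?_ hs0)
      (sum_mul_pow_le_of_le_cost hs0 hsc hc hc2 hM1 hM2)
    refine Finset.sum_le_sum_of_subset_of_nonneg (Finset.range_subset_range.2 hmM) ?_
    intro k hk _
    have hkM : (k : ℝ) + 1 ≤ M := by exact_mod_cast Finset.mem_range.1 hk
    refine mul_nonneg (pow_nonneg (by linarith) _) ?_
    nlinarith
  · exact (weighted_sum_le hs hs1 hcs hmn hb).trans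
      (mul_pow_le_of_cost_le hcs hs1 hc hmM hM1 hM2)

theorem mul_le_sum_mul_prod {a z : ℕ → ℝ} (ha : Antitone a) (ha0 : ∀ i, 0 ≤ a i)
    (hz : ∀ i, z i ∈ Set.Icc (0 : ℝ) 1) {n k : ℕ} (hk : k < n) :
    a k * z k ≤ ∑ i ∈ Finset.range n, a i * (z i * ∏ j ∈ Finset.range i, (1 - z j)) := by
  induction n generalizing a z k with
  | zero => omega
  | succ n ih =>
    have hz0 := hz 0
    have hsum : ∑ i ∈ Finset.range (n + 1), a i * (z i * ∏ j ∈ Finset.range i, (1 - z j)) =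
        (1 - z 0) * ∑ i ∈ Finset.range n,
          a (i + 1) * (z (i + 1) * ∏ j ∈ Finset.range i, (1 - z (j + 1))) + a 0 * z 0 := by
      rw [Finset.sum_range_succ', Finset.mul_sum]
      simp only [Finset.prod_range_succ', Finset.range_zero, Finset.prod_empty, mul_one]
      congr 1
      exact Finset.sum_congr rfl fun i _ => by ring
    rw [hsum]
    cases k with
    | zero =>
      refine le_add_of_nonneg_left (mul_nonneg (sub_nonneg.2 hz0.2) ?_)
      exact Finset.sum_nonneg fun i _ => mul_nonneg (ha0 _) (mul_nonneg (hz _).1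
        (Finset.prod_nonneg fun j _ => sub_nonneg.2 (hz _).2))
    | succ k =>
      have h := ih (a := fun i => a (i + 1)) (z := fun i => z (i + 1))
        (fun i j hij => ha (by omega)) (fun i => ha0 _) (fun i => hz _) (k := k) (by omega)
      have h1 : a (k + 1) * z (k + 1) ≤ a 0 :=
        (mul_le_of_le_one_right (ha0 _) (hz _).2).trans (ha (by omega))
      have h2 := mul_le_mul_of_nonneg_left h (sub_nonneg.2 hz0.2)
      have h3 := mul_le_mul_of_nonneg_left h1 hz0.1
      linarith

theorem netReturn_le_iSup {Ω : Type*} {X : ℕ → Ω → ℝ} (c : ℝ) {n i : ℕ} (hi : i < n) (ω : Ω) :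
    netReturn X c i ω ≤ ⨆ i : Fin n, netReturn X c i ω :=
  le_ciSup (f := fun i : Fin n => netReturn X c i ω) (Set.finite_range _).bddAbove ⟨i, hi⟩

theorem sum_indicator_le_eq {Ω : Type*} {τ : Ω → WithTop ℕ} {N t : ℕ} {ω : Ω} (ht : τ ω = t) (htN : t < N)
    (g : ℕ → Ω → ℝ) :
    ∑ i ∈ Finset.range N, {ω | (i : WithTop ℕ) ≤ τ ω}.indicator (g i) ω =
      ∑ i ∈ Finset.range (t + 1), g i ω := by
  rw [← Finset.sum_subset (Finset.range_subset_range.2 htN)]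
  · refine Finset.sum_congr rfl fun i hi => Set.indicator_of_mem ?_ _
    have : i ≤ t := Nat.lt_succ_iff.1 (Finset.mem_range.1 hi)
    simpa [ht] using this
  · intro i _ hi
    refine Set.indicator_of_notMem ?_ _
    have : t < i := by simpa using hi
    simpa [ht] using this

section IID

variable {Ω : Type*} [MeasurableSpace Ω] {P : Measure Ω} {X : ℕ → Ω → ℝ}

theorem IsUnitIID.ae_mem (hX : IsUnitIID P X) : ∀ᵐ ω ∂P, ∀ i, X i ω ∈ Set.Icc (0 : ℝ) 1 :=
  ae_all_iff.2 fun i => (hX.identDistrib i).symm.ae_mem_snd measurableSet_Icc hX.mem_unit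

theorem IsUnitIID.integral_comp (hX : IsUnitIID P X) {f : ℝ → ℝ} (hf : Measurable f) (i : ℕ) :
    ∫ ω, f (X i ω) ∂P = ∫ ω, f (X 0 ω) ∂P :=
  ((hX.identDistrib i).comp hf).integral_eq

theorem stoppingRules_eq_coe {Y : ℕ → Ω → ℝ} {hY : ∀ i, StronglyMeasurable (Y i)} {N : ℕ}
    {τ : Ω → WithTop ℕ} (hτ : τ ∈ stoppingRules Y hY N) (ω : Ω) :
    ∃ t : ℕ, τ ω = t ∧ t < N ∧ stoppedValue Y τ ω = Y t ω := by
  have h := hτ.2 ω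
  obtain ⟨t, ht⟩ := WithTop.ne_top_iff_exists.1 (h.trans_le le_top).ne
  refine ⟨t, ht.symm, WithTop.coe_lt_coe.1 (ht ▸ h), ?_⟩
  rw [stoppedValue, ← ht]
  rfl

theorem IsUnitIID.integral_sum_indicator_le_stoppingRule (hX : IsUnitIID P X) {c : ℝ} {N : ℕ}
    {τ : Ω → WithTop ℕ}
    (hτ : τ ∈ stoppingRules (netReturn X c) (stronglyMeasurable_netReturn hX.measurable c) N)
    {f : ℕ → ℝ → ℝ} (hf : ∀ i, Measurable (f i))
    (hint : ∀ i, Integrable (fun ω => f i (X i ω)) P) (h0 : ∀ i, ∫ ω, f i (X i ω) ∂P = 0) :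
    Integrable (fun ω => ∑ i ∈ Finset.range N,
        {ω | (i : WithTop ℕ) ≤ τ ω}.indicator (fun ω => f i (X i ω)) ω) P ∧
      ∫ ω, ∑ i ∈ Finset.range N,
        {ω | (i : WithTop ℕ) ≤ τ ω}.indicator (fun ω => f i (X i ω)) ω ∂P = 0 := by
  set ℱ := Filtration.natural (netReturn X c) (stronglyMeasurable_netReturn hX.measurable c)
  have hsucc : ∀ i : ℕ, {ω | ((i + 1 : ℕ) : WithTop ℕ) ≤ τ ω} = {ω | τ ω ≤ (i : WithTop ℕ)}ᶜ := by
    intro i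
    ext ω
    obtain ⟨t, ht, -⟩ := stoppingRules_eq_coe hτ ω
    simp only [Set.mem_ofPred_eq, Set.mem_compl_iff, ht]
    norm_cast
    omega
  have hmeas : ∀ i : ℕ, MeasurableSet {ω | (i : WithTop ℕ) ≤ τ ω} := by
    intro i
    cases i with
    | zero => simp
    | succ i => rw [hsucc]; exact (ℱ.le i _ (hτ.1 i)).compl
  have hint' : ∀ i : ℕ, Integrable
      ({ω | (i : WithTop ℕ) ≤ τ ω}.indicator fun ω => f i (X i ω)) P := fun i =>
    (hint i).indicator (hmeas i)
  refine ⟨integrable_finsetSum _ fun i _ => hint' i, ?_⟩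
  rw [integral_finsetSum _ fun i _ => hint' i]
  refine Finset.sum_eq_zero fun i _ => ?_
  rw [integral_indicator (hmeas i)]
  cases i with
  | zero => simpa using h0 0
  | succ i =>
    have hY : iIndepFun (netReturn X c) P :=
      hX.indep.comp (fun i x => x - ((i : ℝ) + 1) * c) fun i => measurable_id.sub_const _
    have hind := (hY.indep_comap_natural_of_lt
      (stronglyMeasurable_netReturn hX.measurable c) (Nat.lt_succ_self i)).symm
    have hfun : ∀ ω, f (i + 1) (X (i + 1) ω) =
        (fun y => f (i + 1) (y + (((i + 1 : ℕ) : ℝ) + 1) * c)) (netReturn X c (i + 1) ω) := by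
      intro ω
      simp [netReturn]
    have h0' := h0 (i + 1)
    simp_rw [hfun] at h0' ⊢
    refine (hind.setIntegral_eq_mul (ℱ.le i)
      (stronglyMeasurable_netReturn hX.measurable c (i + 1)).measurable.aemeasurable
      (hsucc i ▸ (hτ.1 i).compl)
      ((hf (i + 1)).comp (measurable_id.add_const _)).aestronglyMeasurable).trans ?_
    exact mul_eq_zero_of_right _ h0'

theorem IsUnitIID.integral_mul_prod (hX : IsUnitIID P X) {f g : ℝ → ℝ} (hf : Measurable f)
    (hg : Measurable g) (k : ℕ) :
    ∫ ω, f (X k ω) * ∏ j ∈ Finset.range k, g (X j ω) ∂P =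
      (∫ ω, f (X 0 ω) ∂P) * (∫ ω, g (X 0 ω) ∂P) ^ k := by
  classical
  let F : ℕ → ℝ → ℝ := fun j => if j = k then f else g
  have hF : ∀ j, Measurable (F j) := fun j => by
    by_cases h : j = k <;> simp [F, h, hf, hg]
  have hind := (hX.indep.comp F hF).precomp (g := fun j : Fin (k + 1) => (j : ℕ))
    Fin.val_injective
  have hmeas : ∀ j : Fin (k + 1), AEStronglyMeasurable (F j ∘ X j) P := fun j =>
    ((hF j).comp (hX.measurable j)).aestronglyMeasurable
  have key := hind.integral_fun_prod_eq_prod_integral hmeas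
  have hlt : ∀ j ∈ Finset.range k, F j = g := fun j hj => by
    simp [F, (Finset.mem_range.1 hj).ne]
  have hk : F k = f := by simp [F]
  calc _ = ∫ ω, ∏ j : Fin (k + 1), (F j ∘ X j) ω ∂P := by
        refine integral_congr_ae (Filter.Eventually.of_forall fun ω => ?_)
        simp only
        rw [Fin.prod_univ_eq_prod_range (fun j => (F j ∘ X j) ω) (k + 1),
          Finset.prod_range_succ, mul_comm]
        refine congrArg₂ _ ?_ ?_
        · exact Finset.prod_congr rfl fun j hj => by simp only [hlt j hj, Function.comp_apply]
        · simp only [hk, Function.comp_apply]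
    _ = _ := by
        refine key.trans ?_
        rw [Fin.prod_univ_eq_prod_range (fun j => ∫ ω, (F j ∘ X j) ω ∂P) (k + 1),
          Finset.prod_range_succ, mul_comm]
        congr 1
        · simp only [hk, Function.comp_apply]
          exact hX.integral_comp hf k
        · rw [← Finset.card_range k, ← Finset.prod_const, Finset.card_range]
          exact Finset.prod_congr rfl fun j hj => by
            simp only [hlt j hj, Function.comp_apply]
            exact hX.integral_comp hg j

variable [IsProbabilityMeasure P]

theorem IsUnitIID.integrable_netReturn (hX : IsUnitIID P X) (c : ℝ) (i : ℕ) :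
    Integrable (netReturn X c i) P := by
  refine Integrable.of_mem_Icc (0 - ((i : ℝ) + 1) * c) (1 - ((i : ℝ) + 1) * c)
    ((hX.measurable i).sub_const _).aemeasurable ?_
  filter_upwards [hX.ae_mem] with ω h
  exact ⟨sub_le_sub_right (h i).1 _, sub_le_sub_right (h i).2 _⟩

theorem IsUnitIID.integrable_iSup_netReturn (hX : IsUnitIID P X) {c : ℝ} (hc : 0 ≤ c) (n : ℕ) :
    Integrable (fun ω => ⨆ i : Fin (n + 1), netReturn X c i ω) P := by
  refine Integrable.of_mem_Icc (-c) 1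
    (Measurable.iSup fun i : Fin (n + 1) => (hX.measurable i).sub_const _).aemeasurable ?_
  filter_upwards [hX.ae_mem] with ω h
  refine ⟨?_, ciSup_le fun i => ?_⟩
  · refine le_trans ?_ (netReturn_le_iSup c n.succ_pos ω)
    have := (h 0).1
    simp only [netReturn, Nat.cast_zero]
    linarith
  · have := (h i).2
    have : 0 ≤ ((i : ℕ) + 1 : ℝ) * c := by positivity
    simp only [netReturn]
    linarith

theorem IsUnitIID.integrable_comp (hX : IsUnitIID P X) {f : ℝ → ℝ} (hf : Measurable f) {a b : ℝ}
    (hab : ∀ x ∈ Set.Icc (0 : ℝ) 1, f x ∈ Set.Icc a b) (i : ℕ) :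
    Integrable (fun ω => f (X i ω)) P := by
  refine Integrable.of_mem_Icc a b (hf.comp (hX.measurable i)).aemeasurable ?_
  filter_upwards [hX.ae_mem] with ω h
  exact hab _ (h i)

theorem IsUnitIID.integrable_mul_prod (hX : IsUnitIID P X) {f : ℝ → ℝ} (hf : Measurable f)
    (hf01 : ∀ x ∈ Set.Icc (0 : ℝ) 1, f x ∈ Set.Icc (0 : ℝ) 1) (k : ℕ) :
    Integrable (fun ω => f (X k ω) * ∏ j ∈ Finset.range k, (1 - f (X j ω))) P := by
  refine Integrable.of_mem_Icc 0 1 ((hf.comp (hX.measurable k)).mul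
    (Finset.measurable_fun_prod _ fun j _ =>
      (hf.comp (hX.measurable j)).const_sub 1)).aemeasurable ?_
  filter_upwards [hX.ae_mem] with ω h
  have h0 : ∀ j ∈ Finset.range k, 0 ≤ 1 - f (X j ω) := fun j _ => sub_nonneg.2 (hf01 _ (h j)).2
  have h1 : ∀ j ∈ Finset.range k, 1 - f (X j ω) ≤ 1 := fun j _ => by
    have := (hf01 _ (h j)).1
    linarith
  exact ⟨mul_nonneg (hf01 _ (h k)).1 (Finset.prod_nonneg h0),
    mul_le_one₀ (hf01 _ (h k)).2 (Finset.prod_nonneg h0) (Finset.prod_le_one h0 h1)⟩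

theorem IsUnitIID.integral_sum_mul_prod (hX : IsUnitIID P X) {f : ℝ → ℝ} (hf : Measurable f)
    (hf01 : ∀ x ∈ Set.Icc (0 : ℝ) 1, f x ∈ Set.Icc (0 : ℝ) 1) (a : ℕ → ℝ) (n : ℕ) :
    ∫ ω, ∑ k ∈ Finset.range n, a k * (f (X k ω) * ∏ j ∈ Finset.range k, (1 - f (X j ω))) ∂P =
      ∑ k ∈ Finset.range n,
        a k * ((∫ ω, f (X 0 ω) ∂P) * (1 - ∫ ω, f (X 0 ω) ∂P) ^ k) := by
  rw [integral_finsetSum _ fun k _ => (hX.integrable_mul_prod hf hf01 k).const_mul _]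
  refine Finset.sum_congr rfl fun k _ => ?_
  rw [integral_const_mul, hX.integral_mul_prod hf (g := fun x => 1 - f x) (hf.const_sub 1),
    integral_sub (integrable_const _) (hX.integrable_comp hf hf01 0)]
  simp

/-- The mean of the part of `X` above the level `w`, relative to the distance from `w` to `1`. -/
noncomputable def relExcess (P : Measure Ω) (Z : Ω → ℝ) (w : ℝ) : ℝ :=
  ∫ ω, max (Z ω - w) 0 / (1 - w) ∂P

theorem max_sub_div_mem {w : ℝ} (hw1 : w < 1) :
    ∀ x ∈ Set.Icc (0 : ℝ) 1, max (x - w) 0 / (1 - w) ∈ Set.Icc (0 : ℝ) 1 := by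
  intro x hx
  have : 0 < 1 - w := by linarith
  refine ⟨by positivity, (div_le_one this).2 (max_le (by linarith [hx.2]) this.le)⟩

theorem measurable_max_sub_div (w : ℝ) : Measurable fun x : ℝ => max (x - w) 0 / (1 - w) := by
  fun_prop

theorem IsUnitIID.prophetValue_le (hX : IsUnitIID P X) {c w : ℝ} (hc : 0 ≤ c) (hw1 : w < 1) (n : ℕ) :
    prophetValue P (netReturn X c) (n + 1) ≤
      w - c + relExcess P (X 0) w * (1 - w) + excessBound (relExcess P (X 0) w) (1 - w) c n := by
  have hb : 0 < 1 - w := by linarith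
  set f : ℝ → ℝ := fun x => max (x - w) 0 / (1 - w) with hfdef
  have hf : Measurable f := measurable_max_sub_div w
  have hf01 := max_sub_div_mem hw1
  set a : ℕ → ℝ := fun k => max (1 - w - k * c) 0 with hadef
  have ha : Antitone a := fun i j hij => by
    have : (i : ℝ) ≤ j := by exact_mod_cast hij
    simp only [hadef]
    gcongr
  have hint : Integrable (fun ω => ∑ k ∈ Finset.range (n + 1),
      a k * (f (X k ω) * ∏ j ∈ Finset.range k, (1 - f (X j ω)))) P :=
    integrable_finsetSum _ fun k _ => (hX.integrable_mul_prod hf hf01 k).const_mul _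
  have hle : prophetValue P (netReturn X c) (n + 1) ≤
      ∫ ω, (w - c + ∑ k ∈ Finset.range (n + 1),
        a k * (f (X k ω) * ∏ j ∈ Finset.range k, (1 - f (X j ω)))) ∂P := by
    refine integral_mono_ae (hX.integrable_iSup_netReturn hc n)
      ((integrable_const _).add hint) ?_
    filter_upwards [hX.ae_mem] with ω h
    refine ciSup_le fun i => ?_
    have h1 := mul_le_sum_mul_prod (z := fun j => f (X j ω)) ha (fun _ => le_max_right _ _)
      (fun j => hf01 _ (h j)) i.2
    refine le_trans ?_ (add_le_add_right h1 (w - c))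
    have hz := hf01 _ (h i)
    have h2 : X i ω - w ≤ (1 - w) * f (X i ω) := by
      simp only [hfdef]
      rw [mul_div_cancel₀ _ hb.ne']
      exact le_max_left _ _
    have h3 : (1 - w - (i : ℕ) * c) * f (X i ω) ≤ a i * f (X i ω) :=
      mul_le_mul_of_nonneg_right (le_max_left _ _) hz.1
    have h4 : 0 ≤ ((i : ℕ) : ℝ) * c * (1 - f (X i ω)) :=
      mul_nonneg (by positivity) (sub_nonneg.2 hz.2)
    simp only [netReturn]
    linarith
  refine hle.trans (le_of_eq ?_)
  rw [integral_add (integrable_const _) hint, hX.integral_sum_mul_prod hf hf01,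
    Finset.sum_range_succ', excessBound, Finset.mul_sum]
  have ha0 : a 0 = 1 - w := by simp [hadef, hb.le]
  have hs : ∫ ω, f (X 0 ω) ∂P = relExcess P (X 0) w := rfl
  rw [ha0, hs]
  have hsum : ∑ k ∈ Finset.range n,
      a (k + 1) * (relExcess P (X 0) w * (1 - relExcess P (X 0) w) ^ (k + 1)) =
      ∑ k ∈ Finset.range n, relExcess P (X 0) w *
        ((1 - relExcess P (X 0) w) ^ (k + 1) * max (1 - w - (k + 1) * c) 0) := by
    refine Finset.sum_congr rfl fun k _ => ?_
    simp only [hadef]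
    push_cast
    ring
  rw [hsum]
  simp
  ring

theorem IsUnitIID.integrable_stoppedValue (hX : IsUnitIID P X) {c : ℝ} {N : ℕ}
    {τ : Ω → WithTop ℕ}
    (hτ : τ ∈ stoppingRules (netReturn X c) (stronglyMeasurable_netReturn hX.measurable c) N) :
    Integrable (stoppedValue (netReturn X c) τ) P :=
  MeasureTheory.integrable_stoppedValue ℕ hτ.1 (hX.integrable_netReturn c) fun ω => (hτ.2 ω).le

theorem IsUnitIID.le_optimalValue (hX : IsUnitIID P X) {c : ℝ} (hc : 0 ≤ c) {N : ℕ}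
    {τ : Ω → WithTop ℕ}
    (hτ : τ ∈ stoppingRules (netReturn X c) (stronglyMeasurable_netReturn hX.measurable c) N) :
    ∫ ω, stoppedValue (netReturn X c) τ ω ∂P ≤
      optimalValue P (netReturn X c) (stronglyMeasurable_netReturn hX.measurable c) N := by
  refine le_csSup ⟨1, ?_⟩ ⟨τ, hτ, rfl⟩
  rintro _ ⟨σ, hσ, rfl⟩
  have : ∫ ω, stoppedValue (netReturn X c) σ ω ∂P ≤ ∫ _, (1 : ℝ) ∂P := by
    refine integral_mono_ae (hX.integrable_stoppedValue hσ) (integrable_const _) ?_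
    filter_upwards [hX.ae_mem] with ω h
    obtain ⟨t, -, -, ht⟩ := stoppingRules_eq_coe hσ ω
    rw [ht]
    have := (h t).2
    have : 0 ≤ ((t : ℝ) + 1) * c := by positivity
    simp only [netReturn]
    linarith
  simpa using this

/-- The value of optimal stopping with `k` observations to go, for observations distributed
like the nonnegative variable `Z`, by backward induction. -/
noncomputable def contValue (P : Measure Ω) (Z : Ω → ℝ) (c : ℝ) : ℕ → ℝ
  | 0 => 0
  | k + 1 => ∫ ω, max (Z ω) (contValue P Z c k) ∂P - c

theorem IsUnitIID.integrable_max (hX : IsUnitIID P X) (v : ℝ) (i : ℕ) :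
    Integrable (fun ω => max (X i ω) v) P :=
  hX.integrable_comp (f := fun x => max x v) (by fun_prop) (a := v) (b := max 1 v)
    (fun x hx => ⟨le_max_right _ _, max_le_max_right _ hx.2⟩) i

theorem IsUnitIID.contValue_le_optimalValue (hX : IsUnitIID P X) {c : ℝ} (hc : 0 ≤ c) (n : ℕ) :
    contValue P (X 0) c (n + 1) ≤
      optimalValue P (netReturn X c) (stronglyMeasurable_netReturn hX.measurable c) (n + 1) := by
  set v := contValue P (X 0) c with hv
  have hv0 : v 0 = 0 := rfl
  have hvs : ∀ k, v (k + 1) = ∫ ω, max (X 0 ω) (v k) ∂P - c := fun k => rfl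
  let u : ℕ → Ω → ℝ := fun i ω => X i ω - v (n - i)
  let T : Ω → ℕ := hittingBtwn u (Set.Ici 0) 0 n
  have hTle : ∀ ω, T ω ≤ n := fun ω => hittingBtwn_le ω
  have hτ : (fun ω => (T ω : WithTop ℕ)) ∈ stoppingRules (netReturn X c)
      (stronglyMeasurable_netReturn hX.measurable c) (n + 1) := by
    refine ⟨Adapted.isStoppingTime_hittingBtwn (u := u) (fun i => ?_) measurableSet_Ici,
      fun ω => WithTop.coe_lt_coe.2 (Nat.lt_succ_of_le (hTle ω))⟩
    have h1 := (Filtration.stronglyAdapted_natural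
      (stronglyMeasurable_netReturn hX.measurable c) i).measurable
    have h2 : u i = fun ω => netReturn X c i ω + (((i : ℝ) + 1) * c - v (n - i)) := by
      ext ω
      simp only [u, netReturn]
      ring
    rw [h2]
    exact h1.add_const _
  refine le_trans (le_of_eq ?_) (hX.le_optimalValue hc hτ)
  have hf : ∀ i, Measurable fun x : ℝ => max x (v (n - i)) - c - v (n - i + 1) := fun i => by
    fun_prop
  have hint : ∀ i, Integrable (fun ω => max (X i ω) (v (n - i)) - c - v (n - i + 1)) P := fun i =>
    ((hX.integrable_max _ i).sub (integrable_const _)).sub (integrable_const _)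
  obtain ⟨hI, h0⟩ := hX.integral_sum_indicator_le_stoppingRule hτ hf hint fun i => by
    rw [hX.integral_comp (hf i), integral_sub _ (integrable_const _),
      integral_sub (hX.integrable_max _ 0) (integrable_const _), hvs]
    · simp
    · exact (hX.integrable_max _ 0).sub (integrable_const _)
  have hae : ∀ᵐ ω ∂P, stoppedValue (netReturn X c) (fun ω => (T ω : WithTop ℕ)) ω =
      v (n + 1) + ∑ i ∈ Finset.range (n + 1), {ω | (i : WithTop ℕ) ≤ (T ω : WithTop ℕ)}.indicator
        (fun ω => max (X i ω) (v (n - i)) - c - v (n - i + 1)) ω := by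
    filter_upwards [hX.ae_mem] with ω h
    rw [sum_indicator_le_eq (τ := fun ω => (T ω : WithTop ℕ)) (t := T ω) rfl
      (Nat.lt_succ_of_le (hTle ω)) fun i ω => max (X i ω) (v (n - i)) - c - v (n - i + 1)]
    have hbefore : ∀ t ≤ T ω, ∑ i ∈ Finset.range t,
        (max (X i ω) (v (n - i)) - c - v (n - i + 1)) = v (n + 1 - t) - v (n + 1) - t * c := by
      intro t
      induction t with
      | zero => simp
      | succ t ih =>
        intro ht
        have hnot := notMem_of_lt_hittingBtwn (u := u) (s := Set.Ici 0) (n := 0) (m := n) (ω := ω)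
          (Nat.lt_of_succ_le ht) t.zero_le
        have hlt : X t ω ≤ v (n - t) := by
          simp only [u, Set.mem_Ici, not_le] at hnot
          linarith
        have htn : t < n := lt_of_lt_of_le (Nat.lt_of_succ_le ht) (hTle ω)
        rw [Finset.sum_range_succ, ih (by omega), max_eq_right hlt,
          show n + 1 - t = n - t + 1 by omega, show n + 1 - (t + 1) = n - t by omega]
        push_cast
        ring
    have hat : v (n - T ω) ≤ X (T ω) ω := by
      rcases (hTle ω).eq_or_lt with hn | hn
      · rw [hn, Nat.sub_self, hv0]
        exact (h _).1
      · have := hittingBtwn_mem_set_of_hittingBtwn_lt (u := u) (s := Set.Ici 0) (n := 0) (ω := ω) hn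
        exact sub_nonneg.1 this
    rw [Finset.sum_range_succ, hbefore _ le_rfl, max_eq_left hat,
      show n - T ω + 1 = n + 1 - T ω by have := hTle ω; omega]
    change X (T ω) ω - ((T ω : ℝ) + 1) * c = _
    ring
  rw [integral_congr_ae hae, integral_add (integrable_const _) hI, h0]
  simp

theorem IsUnitIID.integral_max_eq (hX : IsUnitIID P X) {w : ℝ} (hw1 : w < 1) :
    ∫ ω, max (X 0 ω) w ∂P = w + relExcess P (X 0) w * (1 - w) := by
  have hb : 1 - w ≠ 0 := by linarith
  have h : ∀ ω, max (X 0 ω) w = w + max (X 0 ω - w) 0 := fun ω => by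
    rw [← max_add_add_left]; simp
  rw [relExcess, integral_div, div_mul_cancel₀ _ hb]
  simp_rw [h]
  rw [integral_add (integrable_const _)]
  · simp
  · refine ((hX.integrable_max w 0).sub (integrable_const w)).congr (.of_forall fun ω => ?_)
    simp [h]

theorem IsUnitIID.integral_max_ge (hX : IsUnitIID P X) {v w : ℝ} (hvw : v ≤ w) (hw1 : w < 1) :
    v + relExcess P (X 0) w * (1 - v) ≤ ∫ ω, max (X 0 ω) v ∂P := by
  have hb : 0 < 1 - w := by linarith
  have hint := hX.integrable_comp (measurable_max_sub_div w) (max_sub_div_mem hw1) 0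
  calc _ = ∫ ω, (v + max (X 0 ω - w) 0 / (1 - w) * (1 - v)) ∂P := by
        rw [integral_add (integrable_const _) (hint.mul_const _), integral_mul_const]
        simp [relExcess]
    _ ≤ _ := by
        refine integral_mono_ae ((integrable_const _).add (hint.mul_const _))
          (hX.integrable_max v 0) ?_
        filter_upwards [hX.mem_unit] with ω h
        rcases le_total (X 0 ω) w with hle | hle
        · rw [max_eq_right (by linarith)]
          simp
        · rw [max_eq_left (by linarith)]
          refine le_trans ?_ (le_max_left _ _)
          rw [div_mul_eq_mul_div, ← le_sub_iff_add_le', div_le_iff₀ hb]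
          have := mul_nonneg (sub_nonneg.2 h.2) (sub_nonneg.2 hvw)
          nlinarith

theorem IsUnitIID.exists_prophetGap_le (hX : IsUnitIID P X) {c : ℝ} (hc : 0 ≤ c) (n : ℕ) :
    ∃ s b, ExcessAdmissible s b c n ∧
      prophetGap P X hX.measurable c (n + 1) ≤ excessBound s b c n := by
  set v := contValue P (X 0) c with hv
  have hv0 : v 0 = 0 := rfl
  have hvs : ∀ k, v (k + 1) = ∫ ω, max (X 0 ω) (v k) ∂P - c := fun k => rfl
  have hs0 : ∀ w, w < 1 → 0 ≤ relExcess P (X 0) w ∧ relExcess P (X 0) w ≤ 1 := by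
    intro w hw1
    have hint := hX.integrable_comp (measurable_max_sub_div w) (max_sub_div_mem hw1) 0
    constructor
    · refine integral_nonneg_of_ae ?_
      filter_upwards [hX.mem_unit] with ω h using (max_sub_div_mem hw1 _ h).1
    · refine (integral_mono_ae hint (integrable_const 1) ?_).trans (by simp)
      filter_upwards [hX.mem_unit] with ω h using (max_sub_div_mem hw1 _ h).2
  have hv1 : v 1 = relExcess P (X 0) 0 - c := by
    rw [hvs, hv0, hX.integral_max_eq one_pos]
    ring
  have hmono_int : ∀ x y, x ≤ y → ∫ ω, max (X 0 ω) x ∂P ≤ ∫ ω, max (X 0 ω) y ∂P := fun x y hxy =>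
    integral_mono (hX.integrable_max x 0) (hX.integrable_max y 0) fun ω => max_le_max_left _ hxy
  rcases le_or_gt (relExcess P (X 0) 0) c with hlow | hhigh
  · obtain ⟨h0, h1⟩ := hs0 0 one_pos
    refine ⟨relExcess P (X 0) 0, 1, ⟨h0, h1, le_rfl, Or.inl ⟨hlow, rfl⟩⟩, ?_⟩
    have hM := hX.prophetValue_le hc one_pos n
    have hτ : (fun _ => ((0 : ℕ) : WithTop ℕ)) ∈ stoppingRules (netReturn X c)
        (stronglyMeasurable_netReturn hX.measurable c) (n + 1) :=
      ⟨isStoppingTime_const _ _, fun ω => WithTop.coe_lt_coe.2 n.succ_pos⟩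
    have hV := hX.le_optimalValue hc hτ
    change ∫ ω, netReturn X c 0 ω ∂P ≤ _ at hV
    have hE : ∫ ω, netReturn X c 0 ω ∂P = v 1 := by
      have h : ∀ᵐ ω ∂P, netReturn X c 0 ω = max (X 0 ω) 0 - c := by
        filter_upwards [hX.mem_unit] with ω h
        rw [max_eq_left h.1]
        simp [netReturn]
      rw [integral_congr_ae h, integral_sub (hX.integrable_max 0 0) (integrable_const _), hvs, hv0]
      simp
    rw [sub_zero, mul_one] at hM
    unfold prophetGap
    linarith
  · have hmono : Monotone v := by
      refine monotone_nat_of_le_succ fun k => ?_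
      induction k with
      | zero => rw [zero_add, hv1, hv0]; linarith
      | succ k ih =>
        rw [hvs k, hvs (k + 1)]
        exact sub_le_sub_right (hmono_int _ _ ih) c
    have hnn : ∀ k, 0 ≤ v k := fun k => hv0 ▸ hmono k.zero_le
    have hV := hX.contValue_le_optimalValue hc n
    rcases lt_or_ge (v n) 1 with hw1 | hw1
    · have hmax := hX.integral_max_eq hw1
      have hM := hX.prophetValue_le hc hw1 n
      obtain ⟨h0, h1⟩ := hs0 (v n) hw1
      set s := relExcess P (X 0) (v n) with hsdef
      have hgap : prophetGap P X hX.measurable c (n + 1) ≤ excessBound s (1 - v n) c n := by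
        rw [← hv, hvs, hmax] at hV
        unfold prophetGap
        linarith
      have hcs : c ≤ s := by
        have h2 := hmono n.le_succ
        rw [Nat.succ_eq_add_one, hvs, hmax] at h2
        nlinarith [mul_nonneg h0 (hnn n)]
      rcases h0.eq_or_lt with hs | hs
      · refine ⟨0, 1, ⟨le_rfl, zero_le_one, le_rfl, Or.inl ⟨hc, rfl⟩⟩, hgap.trans ?_⟩
        rw [← hs]
        simp [excessBound]
      · refine ⟨s, 1 - v n, ⟨h0, h1, by linarith [hnn n], Or.inr ⟨hs, hcs, ?_⟩⟩, hgap⟩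
        have hlow : ∀ k ≤ n, (1 - c / s) * (1 - (1 - s) ^ k) ≤ v k := by
          intro k
          induction k with
          | zero => simp [hv0]
          | succ k ih =>
            intro hk
            have h2 := hX.integral_max_ge (hmono (by omega : k ≤ n)) hw1
            have h3 := mul_le_mul_of_nonneg_left (ih (by omega)) (sub_nonneg.2 h1)
            rw [hvs]
            have h4 : (1 - c / s) * (1 - (1 - s) ^ (k + 1)) =
                (1 - s) * ((1 - c / s) * (1 - (1 - s) ^ k)) + s - c := by
              field_simp
              ring
            rw [← hsdef] at h2
            linarith
        have := hlow n le_rfl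
        linarith
    · refine ⟨0, 1, ⟨le_rfl, zero_le_one, le_rfl, Or.inl ⟨hc, rfl⟩⟩, ?_⟩
      have h1 : prophetValue P (netReturn X c) (n + 1) ≤ 1 - c := by
        refine (integral_mono_ae (hX.integrable_iSup_netReturn hc n)
          (integrable_const (1 - c)) ?_).trans (by simp)
        filter_upwards [hX.ae_mem] with ω h
        refine ciSup_le fun i => ?_
        have := (h i).2
        have : 0 ≤ ((i : ℕ) : ℝ) * c := by positivity
        simp only [netReturn]
        linarith
      have h2 : 1 ≤ ∫ ω, max (X 0 ω) (v n) ∂P := by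
        refine le_trans (by simp) (integral_mono (μ := P) (integrable_const (1 : ℝ))
          (hX.integrable_max (v n) 0) fun ω => hw1.trans (le_max_right _ _))
      rw [← hv, hvs] at hV
      unfold prophetGap
      simp only [excessBound, zero_mul]
      linarith

end IID

theorem sum_mul_prod_one_sub (z : ℕ → ℝ) (n : ℕ) :
    ∑ k ∈ Finset.range n, z k * ∏ j ∈ Finset.range k, (1 - z j) =
      1 - ∏ j ∈ Finset.range n, (1 - z j) := by
  induction n with
  | zero => simp
  | succ n ih => rw [Finset.sum_range_succ, ih, Finset.prod_range_succ]; ring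

theorem sum_mul_mul_prod_le {a z : ℕ → ℝ} {B : ℝ} (hB : 0 ≤ B) (hz : ∀ i, z i = 0 ∨ z i = 1)
    {n : ℕ} (ha : ∀ k < n, z k = 1 → a k ≤ B) :
    ∑ k ∈ Finset.range n, a k * (z k * ∏ j ∈ Finset.range k, (1 - z j)) ≤ B := by
  have hz1 : ∀ i, 0 ≤ 1 - z i := fun i => by rcases hz i with h | h <;> simp [h]
  calc _ ≤ ∑ k ∈ Finset.range n, B * (z k * ∏ j ∈ Finset.range k, (1 - z j)) := by
        refine Finset.sum_le_sum fun k hk => ?_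
        rcases hz k with h | h
        · simp [h]
        · exact mul_le_mul_of_nonneg_right (ha k (Finset.mem_range.1 hk) h)
            (mul_nonneg (by simp [h]) (Finset.prod_nonneg fun j _ => hz1 j))
    _ = B * (1 - ∏ j ∈ Finset.range n, (1 - z j)) := by
        rw [← Finset.mul_sum, sum_mul_prod_one_sub]
    _ ≤ B := mul_le_of_le_one_right hB
        (sub_le_self _ (Finset.prod_nonneg fun j _ => hz1 j))

section IID

variable {Ω : Type*} [MeasurableSpace Ω] {P : Measure Ω} [IsProbabilityMeasure P]
  {X : ℕ → Ω → ℝ}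

theorem IsUnitIID.le_prophetValue (hX : IsUnitIID P X) (h01 : ∀ᵐ ω ∂P, ∀ i, X i ω = 0 ∨ X i ω = 1)
    {c : ℝ} (hc : 0 ≤ c) {n m : ℕ} (hmn : m ≤ n) :
    (∫ ω, X 0 ω ∂P) - c + (∫ ω, X 0 ω ∂P) * ∑ k ∈ Finset.range m,
        (1 - ∫ ω, X 0 ω ∂P) ^ (k + 1) * (1 - (k + 1) * c) ≤
      prophetValue P (netReturn X c) (n + 1) := by
  have hsum := hX.integral_sum_mul_prod measurable_id (fun x hx => hx)
    (fun k => 1 - (k : ℝ) * c) (m + 1)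
  simp only [id] at hsum
  have hint : Integrable (fun ω => ∑ k ∈ Finset.range (m + 1),
      (1 - (k : ℝ) * c) * (X k ω * ∏ j ∈ Finset.range k, (1 - X j ω))) P :=
    integrable_finsetSum _ fun k _ =>
      (hX.integrable_mul_prod measurable_id (fun x hx => hx) k).const_mul _
  have hle : ∫ ω, (∑ k ∈ Finset.range (m + 1),
      (1 - (k : ℝ) * c) * (X k ω * ∏ j ∈ Finset.range k, (1 - X j ω)) - c) ∂P ≤
      prophetValue P (netReturn X c) (n + 1) := by
    refine integral_mono_ae (hint.sub (integrable_const c))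
      (hX.integrable_iSup_netReturn hc n) ?_
    filter_upwards [h01, hX.ae_mem] with ω h h'
    have h0 := netReturn_le_iSup (X := X) c n.succ_pos ω
    have hX0 := (h' 0).1
    rw [sub_le_iff_le_add]
    refine sum_mul_mul_prod_le ?_ h fun k hk hk1 => ?_
    · simp only [netReturn, Nat.cast_zero] at h0 ⊢
      linarith
    · have := netReturn_le_iSup (X := X) c (by omega : k < n + 1) ω
      simp only [netReturn, hk1] at this ⊢
      linarith
  refine le_trans (le_of_eq ?_) hle
  rw [integral_sub hint (integrable_const c), hsum, Finset.sum_range_succ', Finset.mul_sum]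
  have hterm : ∀ k : ℕ, (∫ ω, X 0 ω ∂P) * ((1 - ∫ ω, X 0 ω ∂P) ^ (k + 1) * (1 - (k + 1) * c)) =
      (1 - ((k + 1 : ℕ) : ℝ) * c) * ((∫ ω, X 0 ω ∂P) * (1 - ∫ ω, X 0 ω ∂P) ^ (k + 1)) := by
    intro k
    push_cast
    ring
  simp only [hterm]
  simp
  ring

theorem IsUnitIID.optimalValue_le (hX : IsUnitIID P X) {c : ℝ} (hpc : ∫ ω, X 0 ω ∂P ≤ c) (n : ℕ) :
    optimalValue P (netReturn X c) (stronglyMeasurable_netReturn hX.measurable c) (n + 1) ≤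
      (∫ ω, X 0 ω ∂P) - c := by
  set p := ∫ ω, X 0 ω ∂P with hp
  have hXint : ∀ i, Integrable (X i) P := fun i =>
    hX.integrable_comp measurable_id (fun x hx => hx) i
  refine csSup_le (Set.Nonempty.image _ ⟨fun _ => ((0 : ℕ) : WithTop ℕ),
    isStoppingTime_const _ _, fun ω => WithTop.coe_lt_coe.2 n.succ_pos⟩) ?_
  rintro _ ⟨τ, hτ, rfl⟩
  obtain ⟨hI, h0⟩ := hX.integral_sum_indicator_le_stoppingRule hτ (f := fun _ x => x - p)
    (fun _ => measurable_id.sub_const p) (fun i => (hXint i).sub (integrable_const p)) fun i => by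
      rw [hX.integral_comp (f := fun x => x - p) (measurable_id.sub_const p),
        integral_sub (hXint 0) (integrable_const p)]
      simp [hp]
  have hle : ∫ ω, stoppedValue (netReturn X c) τ ω ∂P ≤
      ∫ ω, (∑ i ∈ Finset.range (n + 1),
        {ω | (i : WithTop ℕ) ≤ τ ω}.indicator (fun ω => X i ω - p) ω + (p - c)) ∂P := by
    refine integral_mono_ae (hX.integrable_stoppedValue hτ) (hI.add (integrable_const _)) ?_
    filter_upwards [hX.ae_mem] with ω h
    obtain ⟨t, ht, htN, hval⟩ := stoppingRules_eq_coe hτ ω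
    rw [hval, sum_indicator_le_eq ht htN fun i ω => X i ω - p, Finset.sum_range_succ,
      Finset.sum_sub_distrib, Finset.sum_const, Finset.card_range, nsmul_eq_mul, netReturn]
    have h1 : 0 ≤ ∑ i ∈ Finset.range t, X i ω := Finset.sum_nonneg fun i _ => (h i).1
    have h2 : 0 ≤ (t : ℝ) * (c - p) := mul_nonneg t.cast_nonneg (sub_nonneg.2 hpc)
    linarith
  refine hle.trans (le_of_eq ?_)
  rw [integral_add hI (integrable_const _), h0]
  simp

end IID

theorem exists_zero_one_iid {p : ℝ} (hp0 : 0 ≤ p) (hp1 : p ≤ 1) :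
    ∃ (Ω : Type) (_ : MeasurableSpace Ω) (P : Measure Ω) (_ : IsProbabilityMeasure P)
      (X : ℕ → Ω → ℝ), IsUnitIID P X ∧ (∀ᵐ ω ∂P, ∀ i, X i ω = 0 ∨ X i ω = 1) ∧
        ∫ ω, X 0 ω ∂P = p := by
  let μ : Measure ℝ :=
    ENNReal.ofReal p • Measure.dirac 1 + ENNReal.ofReal (1 - p) • Measure.dirac 0
  have hμ : IsProbabilityMeasure μ := ⟨by
    simp only [μ, Measure.add_apply, Measure.smul_apply, measure_univ, smul_eq_mul, mul_one]
    rw [← ENNReal.ofReal_add hp0 (sub_nonneg.2 hp1)]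
    simp⟩
  have hμ01 : ∀ᵐ x ∂μ, x = 0 ∨ x = 1 := by
    refine ae_add_measure_iff.2 ⟨Measure.ae_smul_measure ?_ _, Measure.ae_smul_measure ?_ _⟩ <;>
      rw [ae_dirac_eq] <;> simp
  have hmean : ∫ x, x ∂μ = p := by
    have hi : ∀ (a r : ℝ), Integrable (fun x : ℝ => x) (ENNReal.ofReal r • Measure.dirac a) :=
      fun a r => (integrable_dirac (by simp)).smul_measure ENNReal.ofReal_ne_top
    rw [integral_add_measure (hi _ _) (hi _ _), integral_smul_measure, integral_smul_measure]
    simp [hp0]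
  let P : Measure (ℕ → ℝ) := Measure.infinitePi fun _ => μ
  have hmap : ∀ i, P.map (fun ω => ω i) = μ := fun i => Measure.infinitePi_map_eval _ i
  have hev : ∀ i, Measurable fun ω : ℕ → ℝ => ω i := fun i => measurable_pi_apply i
  have h01 : ∀ᵐ ω ∂P, ∀ i, ω i = 0 ∨ ω i = 1 := ae_all_iff.2 fun i =>
    ae_of_ae_map (hev i).aemeasurable (p := fun x : ℝ => x = 0 ∨ x = 1) (by rwa [hmap])
  refine ⟨ℕ → ℝ, inferInstance, P, inferInstance, fun i ω => ω i, ⟨hev, ?_, fun i => ?_, ?_⟩,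
    h01, ?_⟩
  · exact iIndepFun_infinitePi (X := fun _ x => x) fun _ => measurable_id
  · exact ⟨(hev i).aemeasurable, (hev 0).aemeasurable, by rw [hmap, hmap]⟩
  · filter_upwards [h01] with ω h
    rcases h 0 with h | h <;> simp [h]
  · rw [← hmean, ← hmap 0, integral_map (hev 0).aemeasurable]
    exact aestronglyMeasurable_id

theorem isAttainedGap_of_forall_le {c p d : ℝ} (hp0 : 0 ≤ p) (hp1 : p ≤ 1) (hpc : p ≤ c)
    {n m : ℕ} (hmn : m ≤ n)
    (hle : ∀ (Ω : Type) [MeasurableSpace Ω] (P : Measure Ω) [IsProbabilityMeasure P]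
      (X : ℕ → Ω → ℝ) (hX : IsUnitIID P X), prophetGap P X hX.measurable c (n + 1) ≤ d)
    (hd : d = p * ∑ k ∈ Finset.range m, (1 - p) ^ (k + 1) * (1 - (k + 1) * c)) :
    IsAttainedGap c (n + 1) d := by
  obtain ⟨Ω, _, P, _, X, hX, h01, hmean⟩ := exists_zero_one_iid hp0 hp1
  refine ⟨Ω, inferInstance, P, inferInstance, X, hX, le_antisymm (hle Ω P X hX) ?_⟩
  have hM := hX.le_prophetValue h01 (hp0.trans hpc) hmn
  have hV := hX.optimalValue_le (hmean.le.trans hpc) n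
  rw [hmean] at hM hV
  unfold prophetGap
  linarith

theorem exists_nat_strictFloor_one_div {c : ℝ} (hc : 0 < c) :
    ∃ M : ℕ, strictFloor (1 / c) = M ∧ M * c < 1 ∧ 1 ≤ (M + 1) * c := by
  have h1 : 0 < ⌈1 / c⌉ := Int.ceil_pos.2 (by positivity)
  have hM : ((strictFloor (1 / c)).toNat : ℤ) = strictFloor (1 / c) :=
    Int.toNat_of_nonneg (by unfold strictFloor; omega)
  have hM' : ((strictFloor (1 / c)).toNat : ℝ) = ⌈1 / c⌉ - 1 := by
    rw [← Int.cast_natCast, hM, strictFloor]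
    push_cast
    rfl
  refine ⟨(strictFloor (1 / c)).toNat, hM.symm, ?_, ?_⟩
  · rw [← lt_div_iff₀ hc, hM']
    linarith [Int.ceil_lt_add_one (1 / c)]
  · rw [← div_le_iff₀ hc, hM']
    linarith [Int.le_ceil (1 / c)]

theorem tendsto_horizonBound :
    Filter.Tendsto horizonBound Filter.atTop (nhds (Real.exp (-1))) := by
  have h1 := (Filter.tendsto_add_atTop_iff_nat 2).2 (Real.tendsto_one_add_div_pow_exp (-1))
  have h2 := tendsto_natCast_div_add_atTop (1 : ℝ)
  have h3 := h2.mul h1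
  rw [one_mul] at h3
  refine h3.congr fun n => ?_
  have h0 : 1 - 1 / ((n : ℝ) + 2) = ((n : ℝ) + 1) / (n + 2) := by field_simp; ring
  have h0' : 1 + -1 / (((n + 2 : ℕ) : ℝ)) = ((n : ℝ) + 1) / (n + 2) := by
    push_cast; field_simp; ring
  rw [horizonBound, h0, h0', pow_succ _ (n + 1)]
  field_simp

theorem IsUnitIID.prophetGap_le_horizonBound {Ω : Type*} [MeasurableSpace Ω] {P : Measure Ω}
    [IsProbabilityMeasure P] {X : ℕ → Ω → ℝ} (hX : IsUnitIID P X) {c : ℝ} (hc : 0 ≤ c) (n : ℕ) :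
    prophetGap P X hX.measurable c (n + 1) ≤ horizonBound n := by
  obtain ⟨s, b, h, hle⟩ := hX.exists_prophetGap_le hc n
  exact hle.trans (excessBound_le_horizonBound hc h)

theorem IsUnitIID.prophetGap_le_of_half_le {Ω : Type*} [MeasurableSpace Ω] {P : Measure Ω}
    [IsProbabilityMeasure P] {X : ℕ → Ω → ℝ} (hX : IsUnitIID P X) {c : ℝ} (hc : 1 / 2 ≤ c)
    (hc1 : c ≤ 1) (n : ℕ) :
    prophetGap P X hX.measurable c (n + 1) ≤ (1 - c) / 4 := by
  obtain ⟨s, b, h, hle⟩ := hX.exists_prophetGap_le (by linarith : 0 ≤ c) n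
  exact hle.trans (excessBound_le_of_half_le hc hc1 h)

theorem IsUnitIID.prophetGap_le_of_le_half {Ω : Type*} [MeasurableSpace Ω] {P : Measure Ω}
    [IsProbabilityMeasure P] {X : ℕ → Ω → ℝ} (hX : IsUnitIID P X) {c : ℝ} (hc : 0 < c)
    (hc2 : c ≤ 1 / 2) {M : ℕ} (hM1 : M * c < 1) (hM2 : 1 ≤ (M + 1) * c) (n : ℕ) :
    prophetGap P X hX.measurable c (n + 1) ≤ M * (c * (1 - c) ^ (M + 1)) := by
  obtain ⟨s, b, h, hle⟩ := hX.exists_prophetGap_le hc.le n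
  exact hle.trans (excessBound_le_of_le_half hc hc2 hM1 hM2 h)

theorem isAttainedGap_of_le_half {c : ℝ} (hc : 0 < c) (hc2 : c ≤ 1 / 2) {M : ℕ}
    (hM1 : M * c < 1) (hM2 : 1 ≤ (M + 1) * c) :
    IsAttainedGap c (M + 1) (M * (c * (1 - c) ^ (M + 1))) :=
  isAttainedGap_of_forall_le hc.le (by linarith) le_rfl le_rfl
    (fun _ _ _ _ _ hX => hX.prophetGap_le_of_le_half hc hc2 hM1 hM2 M)
    (sum_mul_pow_at_cost hc M).symm

theorem isAttainedGap_of_half_le {c : ℝ} (hc : 1 / 2 ≤ c) (hc1 : c ≤ 1) :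
    IsAttainedGap c 2 ((1 - c) / 4) :=
  isAttainedGap_of_forall_le (p := 1 / 2) (n := 1) (m := 1) (by norm_num) (by norm_num) hc le_rfl
    (fun _ _ _ _ _ hX => hX.prophetGap_le_of_half_le hc hc1 1) (by norm_num; ring)

theorem isAttainedGap_horizonBound (n : ℕ) :
    IsAttainedGap (1 / ((n : ℝ) + 2)) (n + 1) (horizonBound n) := by
  have hc : 0 < 1 / ((n : ℝ) + 2) := by positivity
  have hc1 : 1 / ((n : ℝ) + 2) ≤ 1 := by
    rw [div_le_one (by positivity)]
    have : (0 : ℝ) ≤ n := n.cast_nonneg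
    linarith
  exact isAttainedGap_of_forall_le hc.le hc1 le_rfl le_rfl
    (fun _ _ _ _ _ hX => hX.prophetGap_le_horizonBound hc.le n) (sum_mul_pow_at_cost hc n).symm

theorem mainTheorem1 :
    -- the three upper bounds, on every probability space
    (∀ {Ω : Type*} [MeasurableSpace Ω] (P : Measure Ω) [IsProbabilityMeasure P]
        (X : ℕ → Ω → ℝ) (hX : IsUnitIID P X),
      (∀ c : ℝ, 0 < c → c ≤ 1 → ∀ n : ℕ, 1 ≤ n →
        (c ≤ 1 / 2 → prophetGap P X hX.measurable c n ≤
          (strictFloor (1 / c) : ℝ) * c * (1 - c) ^ (strictFloor (1 / c) + 1)) ∧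
        (1 / 2 ≤ c → prophetGap P X hX.measurable c n ≤ (1 - c) / 4)) ∧
      (∀ n : ℕ, 1 ≤ n → ∀ c : ℝ, 0 ≤ c →
        prophetGap P X hX.measurable c n ≤
          ((n : ℝ) - 1) * (1 - 1 / ((n : ℝ) + 1)) ^ n / ((n : ℝ) + 1)) ∧
      (∀ c : ℝ, 0 ≤ c → ∀ n : ℕ, 1 ≤ n →
        prophetGap P X hX.measurable c n < Real.exp (-1))) ∧
    -- the first bound is attained for every admissible `c`
    (∀ c : ℝ, 0 < c → c ≤ 1 → ∃ n : ℕ, 1 ≤ n ∧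
      (c ≤ 1 / 2 → IsAttainedGap c n
        ((strictFloor (1 / c) : ℝ) * c * (1 - c) ^ (strictFloor (1 / c) + 1))) ∧
      (1 / 2 ≤ c → IsAttainedGap c n ((1 - c) / 4))) ∧
    -- the second bound is attained for every `n`
    (∀ n : ℕ, 1 ≤ n → ∃ c : ℝ, 0 ≤ c ∧ IsAttainedGap c n
      (((n : ℝ) - 1) * (1 - 1 / ((n : ℝ) + 1)) ^ n / ((n : ℝ) + 1))) ∧
    -- no constant smaller than `1 / e` works in the third bound
    (∀ b : ℝ, b < Real.exp (-1) →
      ∃ c : ℝ, 0 ≤ c ∧ ∃ n : ℕ, 1 ≤ n ∧ ∃ d : ℝ, b < d ∧ IsAttainedGap c n d) := by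
  have hpow : ∀ (c : ℝ) (M : ℕ), (((M : ℤ) : ℝ) * c * (1 - c) ^ ((M : ℤ) + 1)) =
      M * (c * (1 - c) ^ (M + 1)) := fun c M => by
    rw [show ((M : ℤ) + 1) = ((M + 1 : ℕ) : ℤ) by push_cast; rfl, zpow_natCast, Int.cast_natCast,
      mul_assoc]
  refine ⟨fun P _ X hX => ⟨fun c hc hc1 N hN => ?_, fun N hN c hc => ?_, fun c hc N hN => ?_⟩,
    fun c hc hc1 => ?_, fun N hN => ?_, fun b hb => ?_⟩
  · obtain ⟨n, rfl⟩ := Nat.exists_eq_add_of_le' hN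
    refine ⟨fun h => ?_, fun h => hX.prophetGap_le_of_half_le h hc1 n⟩
    obtain ⟨M, hM, hM1, hM2⟩ := exists_nat_strictFloor_one_div hc
    rw [hM, hpow]
    exact hX.prophetGap_le_of_le_half hc h hM1 hM2 n
  · obtain ⟨n, rfl⟩ := Nat.exists_eq_add_of_le' hN
    rw [← horizonBound_eq]
    exact hX.prophetGap_le_horizonBound hc n
  · obtain ⟨n, rfl⟩ := Nat.exists_eq_add_of_le' hN
    exact (hX.prophetGap_le_horizonBound hc n).trans_lt (horizonBound_lt_exp n)
  · by_cases h : c ≤ 1 / 2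
    · obtain ⟨M, hM, hM1, hM2⟩ := exists_nat_strictFloor_one_div hc
      have hatt := isAttainedGap_of_le_half hc h hM1 hM2
      refine ⟨M + 1, by omega, fun _ => by rwa [hM, hpow], fun h' => ?_⟩
      obtain rfl : c = 1 / 2 := le_antisymm h h'
      have h1 : (M : ℝ) < 2 := by linarith
      have h2 : (1 : ℝ) ≤ M := by linarith
      obtain rfl : M = 1 := by
        have h1' : M < 2 := by exact_mod_cast h1
        have h2' : 1 ≤ M := by exact_mod_cast h2
        omega
      exact isAttainedGap_of_half_le le_rfl hc1
    · exact ⟨2, by omega, fun h' => absurd h' h, fun h' => isAttainedGap_of_half_le h' hc1⟩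
  · obtain ⟨n, rfl⟩ := Nat.exists_eq_add_of_le' hN
    rw [← horizonBound_eq]
    exact ⟨_, by positivity, isAttainedGap_horizonBound n⟩
  · obtain ⟨n, hn⟩ := (tendsto_horizonBound.eventually_const_lt hb).exists
    exact ⟨_, by positivity, n + 1, by omega, _, hn, isAttainedGap_horizonBound n⟩
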